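/- Let $T>1$ and $N\ge 1$ be integers, let $|\cdot|$ and $(\cdot,\cdot)$ be the Euclidean norm and inner product of $\mathbb R^N$, write $\mathbb Z[1,T]=\{1,\dots,T\}$ and $\Delta h(t)=h(t+1)-h(t)$. Let $\rho_i:\mathbb Z\to\mathbb R$, $\phi_i:\mathbb R^N\to\mathbb R^N$, $\Phi_i:\mathbb R^N\to[0,\infty)$ ($i=1,2,3,4$) and $F,G,H:\mathbb Z\times\mathbb R^N\times\mathbb R^N\to\mathbb R$ satisfy: ($\rho$) each $\rho_i$ is $T$-periodic and $\min_{t\in\mathbb Z[1,T]}\rho_i(t)>0$; (A1) each $\phi_i$ is a homeomorphism of $\mathbb R^N$ onto itself with $\phi_i(0)=0$ and $\phi_i=\nabla\Phi_i$, where $\Phi_i\in C^1$ is strictly convex and $\Phi_i(0)=0$; (A2) $F,G,H$ are $T$-periodic in $t$ and, for each $t\in\mathbb Z[1,T]$, continuously differentiable in $(x_1,x_2)$; (A3) there are $\theta>1$ and $c_i>0$ with $(\phi_i(x)-\phi_i(y),x-y)\ge c_i|x-y|^\theta$ for all $x,y\in\mathbb R^N$; (A4) $\Phi_i(x)\to+\infty$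 as $|x|\to\infty$, and there are $l\ge\theta$, $d_i>0$, $m_i>0$ with $\Phi_i(x)\le d_i|x|^l+m_i$ for all $x\in\mathbb R^N$; (A5) for each $t\in\mathbb Z[1,T]$, $\displaystyle\lim_{|x_1|+|x_2|\to\infty}\frac{F(t,x_1,x_2)}{|x_1|^l+|x_2|^l}=+\infty$, and for each $\lambda>0$ there is $C_0\in\mathbb R$ with $\lambda G(t,x_1,x_2)\ge F(t,x_1,x_2)+C_0$ for all $x_1,x_2\in\mathbb R^N$; (A6) $\sum_{t=1}^T G(t,0,0)=0$. Let $E=E_T\times E_T$, where $E_T$ is the space of $T$-periodic sequences $h:\mathbb Z\to\mathbb R^N$, with the norm $\|u\|=\|u_1\|_{E_T}+\|u_2\|_{E_T}$, where $\|h\|_{E_T}=\big(\sum_{t=1}^T|\Delta h(t)|^\theta+\sum_{t=1}^T|h(t)|^\theta\big)^{1/\theta}$. For $u=(u_1,u_2)\in E$ put $$I(u)=\sum_{t=1}^T\big[\rho_1(t)\Phi_1(\Delta u_1(t))+\rho_2(t)\Phi_2(\Delta u_2(t))+\rho_3(t)\Phi_3(u_1(t))+\rho_4(t)\Phi_4(u_2(t))\big],$$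 $$\Psi(u)=-\sum_{t=1}^TF(t,u_1(t),u_2(t)),\qquad \Phi(u)=\sum_{t=1}^TG(t,u_1(t),u_2(t)),$$ and for $r>0$, $\mu\in\mathbb R$, $$\beta(\mu I+\Psi,\Phi,r)=\sup_{u\in E,\ \Phi(u)>r}\frac{\mu I(u)+\Psi(u)-\inf_{\Phi^{-1}(]-\infty,r])}(\mu I+\Psi)}{r-\Phi(u)},$$ $$\mu^*(I,\Psi,\Phi,r)=\inf\Big\{\frac{\Psi(u)-\gamma+r}{\eta_r-I(u)}:u\in E,\ \Phi(u)<r,\ I(u)<\eta_r\Big\},\quad \gamma=\inf_E(\Psi+\Phi),\quad \eta_r=\inf_{\Phi^{-1}(r)}I.$$ Then for each $r>0$, each $\mu>\max\{0,\mu^*(I,\Psi,\Phi,r)\}$ and each compact interval $[a,b]\subset\,]0,\beta(\mu I+\Psi,\Phi,r)[$, there is a number $R>0$ with the following property: for every $\lambda\in[a,b]$ there is $\delta>0$ such that, for each $\nu\in[0,\delta]$, the system $$\begin{cases}\mu\Delta\big[\rho_1(t-1)\phi_1(\Delta u_1(t-1))\big]-\mu\rho_3(t)\phi_3(u_1(t))+\nabla_{u_1}W(t,u_1(t),u_2(t))=0,\\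 \mu\Delta\big[\rho_2(t-1)\phi_2(\Delta u_2(t-1))\big]-\mu\rho_4(t)\phi_4(u_2(t))+\nabla_{u_2}W(t,u_1(t),u_2(t))=0\end{cases}\qquad(t\in\mathbb Z)$$ with $W=F-\lambda G+\nu H$ has at least three distinct $T$-periodic solutions $u=(u_1,u_2)\in E$ with $\|u\|<R$. -/

import Mathlib

noncomputable section

namespace PhiLaplacian

/-- `ℝ^N` with the Euclidean norm and inner product. -/
abbrev Vec (N : ℕ) : Type := EuclideanSpace ℝ (Fin N)

/-- `E_T`: the space of `T`-periodic sequences `ℤ → ℝ^N`. -/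
def PerSeq (N T : ℕ) : Submodule ℝ (ℤ → Vec N) where
  carrier := {h | ∀ t : ℤ, h (t + (T : ℤ)) = h t}
  add_mem' := by
    intro a b ha hb t
    simp only [Set.mem_ofPred_eq] at ha hb
    simp [ha t, hb t]
  zero_mem' := by
    intro t
    rfl
  smul_mem' := by
    intro c a ha t
    simp only [Set.mem_ofPred_eq] at ha
    simp [ha t]

/-- `E = E_T × E_T`. -/
abbrev PerPair (N T : ℕ) : Type := PerSeq N T × PerSeq N T

/-- Forward difference `Δ h (t) = h (t + 1) - h t`. -/
def fdiff {N : ℕ} (h : ℤ → Vec N) (t : ℤ) : Vec N := h (t + 1) - h t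

/-- `‖h‖_{E_T} = (∑_{t=1}^T |Δ h(t)|^θ + ∑_{t=1}^T |h(t)|^θ)^{1/θ}`. -/
def normSeq {N T : ℕ} (θ : ℝ) (h : PerSeq N T) : ℝ :=
  ((∑ t ∈ Finset.Icc (1 : ℤ) T, ‖fdiff h.1 t‖ ^ θ)
    + ∑ t ∈ Finset.Icc (1 : ℤ) T, ‖h.1 t‖ ^ θ) ^ (1 / θ)

/-- `‖u‖ = ‖u₁‖_{E_T} + ‖u₂‖_{E_T}`. -/
def normPair {N T : ℕ} (θ : ℝ) (u : PerPair N T) : ℝ :=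
  normSeq θ u.1 + normSeq θ u.2

/-! The four weights `ρ₁, …, ρ₄`, maps `φ₁, …, φ₄` and potentials `Φ₁, …, Φ₄` are families over
`Fin 4`, so that the indices `0, 1, 2, 3` stand for `1, 2, 3, 4`. -/

/-- Each weight is `T`-periodic and positive on `{1, …, T}`. -/
def CondRho (T : ℕ) (ρ : Fin 4 → ℤ → ℝ) : Prop :=
  ∀ i, (∀ t : ℤ, ρ i (t + (T : ℤ)) = ρ i t) ∧ ∀ t ∈ Finset.Icc (1 : ℤ) T, 0 < ρ i t

/-- Classical homeomorphisms `φ_i = ∇Φ_i`. -/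
def CondA1 {N : ℕ} (φ : Fin 4 → Vec N → Vec N) (Φ : Fin 4 → Vec N → ℝ) : Prop :=
  ∀ i, IsHomeomorph (φ i) ∧ φ i 0 = 0 ∧ (∀ x, HasGradientAt (Φ i) (φ i x) x) ∧
    ContDiff ℝ 1 (Φ i) ∧ (∀ x, 0 ≤ Φ i x) ∧ StrictConvexOn ℝ Set.univ (Φ i) ∧ Φ i 0 = 0

/-- `K(t, x₁, x₂)` is `T`-periodic in `t` and `C¹` in `(x₁, x₂)` for `t ∈ {1, …, T}`. -/
def CondA2 {N : ℕ} (T : ℕ) (K : ℤ → Vec N → Vec N → ℝ) : Prop :=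
  (∀ (t : ℤ) (x₁ x₂ : Vec N), K (t + (T : ℤ)) x₁ x₂ = K t x₁ x₂) ∧
    ∀ t ∈ Finset.Icc (1 : ℤ) T, ContDiff ℝ 1 (fun x : Vec N × Vec N => K t x.1 x.2)

def CondA3 {N : ℕ} (φ : Fin 4 → Vec N → Vec N) (θ : ℝ) : Prop :=
  1 < θ ∧ ∃ c : Fin 4 → ℝ, (∀ i, 0 < c i) ∧
    ∀ i x y, c i * ‖x - y‖ ^ θ ≤ inner ℝ (φ i x - φ i y) (x - y)

def CondA4 {N : ℕ} (Φ : Fin 4 → Vec N → ℝ) (θ l : ℝ) : Prop :=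
  (∀ i, Filter.Tendsto (Φ i) (Filter.comap (fun x : Vec N => ‖x‖) Filter.atTop) Filter.atTop) ∧
    θ ≤ l ∧ ∃ d m : Fin 4 → ℝ, (∀ i, 0 < d i) ∧ (∀ i, 0 < m i) ∧
      ∀ i x, Φ i x ≤ d i * ‖x‖ ^ l + m i

def CondA5 {N : ℕ} (T : ℕ) (F G : ℤ → Vec N → Vec N → ℝ) (l : ℝ) : Prop :=
  ∀ t ∈ Finset.Icc (1 : ℤ) T,
    Filter.Tendsto (fun x : Vec N × Vec N => F t x.1 x.2 / (‖x.1‖ ^ l + ‖x.2‖ ^ l))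
      (Filter.comap (fun x : Vec N × Vec N => ‖x.1‖ + ‖x.2‖) Filter.atTop) Filter.atTop ∧
    ∀ lam : ℝ, 0 < lam → ∃ C₀ : ℝ, ∀ x₁ x₂ : Vec N, F t x₁ x₂ + C₀ ≤ lam * G t x₁ x₂

def CondA6 {N : ℕ} (T : ℕ) (G : ℤ → Vec N → Vec N → ℝ) : Prop :=
  ∑ t ∈ Finset.Icc (1 : ℤ) T, G t 0 0 = 0

/-- The functional `I` on `E`. -/
def funI {N T : ℕ} (ρ : Fin 4 → ℤ → ℝ) (Φ : Fin 4 → Vec N → ℝ) (u : PerPair N T) : ℝ :=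
  ∑ t ∈ Finset.Icc (1 : ℤ) T,
    (ρ 0 t * Φ 0 (fdiff u.1.1 t) + ρ 1 t * Φ 1 (fdiff u.2.1 t)
      + ρ 2 t * Φ 2 (u.1.1 t) + ρ 3 t * Φ 3 (u.2.1 t))

/-- `u ↦ ∑_{t=1}^T K(t, u₁(t), u₂(t))` on `E`. -/
def funSum {N T : ℕ} (K : ℤ → Vec N → Vec N → ℝ) (u : PerPair N T) : ℝ :=
  ∑ t ∈ Finset.Icc (1 : ℤ) T, K t (u.1.1 t) (u.2.1 t)

/-- The functional `Ψ` on `E`. -/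
def funPsi {N T : ℕ} (F : ℤ → Vec N → Vec N → ℝ) (u : PerPair N T) : ℝ := -funSum F u

/-- The functional `Φ` on `E`. -/
def funPhi {N T : ℕ} (G : ℤ → Vec N → Vec N → ℝ) (u : PerPair N T) : ℝ := funSum G u

/-- `β(J, Φ, r)`, the supremum being taken in the extended reals. -/
def beta {X : Type} (J Φ : X → ℝ) (r : ℝ) : EReal :=
  ⨆ (u : X) (_ : r < Φ u), (((J u - sInf (J '' {x | Φ x ≤ r})) / (r - Φ u) : ℝ) : EReal)

/-- `γ = inf_X (Ψ + Φ)`. -/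
def gammaInf {X : Type} (Ψ Φ : X → ℝ) : ℝ := sInf (Set.range fun u => Ψ u + Φ u)

/-- `η_r = inf_{Φ⁻¹(r)} I`. -/
def etaInf {X : Type} (I Φ : X → ℝ) (r : ℝ) : ℝ := sInf (I '' {u | Φ u = r})

/-- `μ*(I, Ψ, Φ, r)`, the infimum being taken in the extended reals. -/
def muStar {X : Type} (I Ψ Φ : X → ℝ) (r : ℝ) : EReal :=
  ⨅ (u : X) (_ : Φ u < r ∧ I u < etaInf I Φ r),
    (((Ψ u - gammaInf Ψ Φ + r) / (etaInf I Φ r - I u) : ℝ) : EReal)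

/-- `W = F - λ G + ν H`. -/
def potW {N : ℕ} (F G H : ℤ → Vec N → Vec N → ℝ) (lam ν : ℝ) (t : ℤ) (x₁ x₂ : Vec N) : ℝ :=
  F t x₁ x₂ - lam * G t x₁ x₂ + ν * H t x₁ x₂

/-- The pair `u` solves the difference system with parameter `μ` and potential `W` at every
integer `t`. -/
def IsSolution {N T : ℕ} (ρ : Fin 4 → ℤ → ℝ) (φ : Fin 4 → Vec N → Vec N)
    (W : ℤ → Vec N → Vec N → ℝ) (μ : ℝ) (u : PerPair N T) : Prop :=
  ∀ t : ℤ,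
    μ • fdiff (fun s => ρ 0 (s - 1) • φ 0 (fdiff u.1.1 (s - 1))) t
        - (μ * ρ 2 t) • φ 2 (u.1.1 t)
        + gradient (fun x => W t x (u.2.1 t)) (u.1.1 t) = 0 ∧
    μ • fdiff (fun s => ρ 1 (s - 1) • φ 1 (fdiff u.2.1 (s - 1))) t
        - (μ * ρ 3 t) • φ 3 (u.2.1 t)
        + gradient (fun x => W t (u.1.1 t) x) (u.2.1 t) = 0

end PhiLaplacian

end

/-! Fix `μ` and put `J = μI + Ψ`; the critical points of `J + λΦ - ν∑H` are sought on the
finite-dimensional space `E`. The level set `{Φ = r}` acts as a wall between two wells. Since `μ >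
μ*`, some `v₀` with `Φ(v₀) < r` satisfies `J(v₀) < L₀`, where `L₀ ≤ J` on the wall
(`exists_lt_level_of_muStar_lt`). Since `b < β`, some `v₁` with `Φ(v₁) > r` satisfies `J(v₁) +
b(Φ(v₁) - r) < L₁`, where `L₁` is the infimum of `J` on `{Φ ≤ r}` (`exists_lt_sInf_of_lt_beta`).
After adding `λΦ` with `0 < λ ≤ b`, both points lie strictly below `max L₀ L₁ + λr`, a lower bound
for `J + λΦ` on the wall.

Coercivity (`isCompact_sublevel`) then gives a local minimum on each side, and the mountain pass
theorem gives a third critical point at or above the height of the wall. These strict inequalities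
survive a small bounded perturbation. An arbitrary `C¹` perturbation is cut off outside a ball that
already contains all the critical points found, with a radius independent of `λ`
(`exists_three_critical_points_of_perturbation`). Summation by parts turns critical points into
solutions (`isSolution_of_hasDerivAt_zero`). -/

open Set Filter Topology

/-! ### Critical point theory for coercive `C¹` functions in finite dimension. -/

section MountainPass

variable {E : Type*} [NormedAddCommGroup E] [InnerProductSpace ℝ E] [FiniteDimensional ℝ E]

/-- A coercive `C¹` function without critical points at level `c` is pushed strictly below `c` on
the sublevel set of `c` by one small gradient step. -/
theorem exists_gradient_step_lt {f : E → ℝ} (hf : ContDiff ℝ 1 f) {c : ℝ}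
    (hK : IsCompact {x | f x ≤ c}) (hc : ∀ x, f x = c → gradient f x ≠ 0) :
    ∃ s : ℝ, 0 < s ∧ ∀ x, f x ≤ c → f (x - s • gradient f x) < c := by
  have hg : Continuous (gradient f) :=
    (InnerProductSpace.toDual ℝ E).symm.continuous.comp (hf.continuous_fderiv one_ne_zero)
  have hstep : Continuous fun z : ℝ × E => z.2 - z.1 • gradient f z.2 := by fun_prop
  -- Compactness of the sublevel set reduces a uniform step size to a local statement near each `(0,
  -- x)`.
  have key : ∀ᶠ s in 𝓝 (0 : ℝ), ∀ x ∈ {x | f x ≤ c},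
      (0 < s → f x ≤ c → f (x - s • gradient f x) < c) := by
    refine hK.eventually_forall_of_forall_eventually fun x hx => ?_
    rcases lt_or_eq_of_le (show f x ≤ c from hx) with hlt | heq
    · have : ∀ᶠ z : ℝ × E in 𝓝 (0, x), f (z.2 - z.1 • gradient f z.2) < c := by
        refine (hf.continuous.comp hstep).continuousAt.eventually_lt continuousAt_const ?_
        simpa using hlt
      filter_upwards [this] with z hz _ _ using hz
    -- Strict differentiability is needed because both endpoints of the increment vary near `x`.
    -- With tolerance `‖g‖ / 4` the linear decrease is at least `s · (3/4)‖g‖²` and the error at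
    -- most `s · (1/2)‖g‖²`.
    · have hstrict := (hf.contDiffAt (x := x)).hasStrictFDerivAt one_ne_zero
      set g := gradient f x with hgdef
      have hgpos : 0 < ‖g‖ := norm_pos_iff.2 (hc x heq)
      have hlin := (hasStrictFDerivAt_iff_isLittleO.1 hstrict).def (show 0 < ‖g‖ / 4 by positivity)
      have hT : Tendsto (fun z : ℝ × E => (z.2 - z.1 • gradient f z.2, z.2)) (𝓝 (0, x))
          (𝓝 (x, x)) := by
        have : Continuous fun z : ℝ × E => (z.2 - z.1 • gradient f z.2, z.2) :=
          hstep.prodMk continuous_snd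
        simpa using this.tendsto (0, x)
      have hclose : ∀ᶠ z : ℝ × E in 𝓝 (0, x), ‖gradient f z.2 - g‖ < ‖g‖ / 4 := by
        have h1 : Continuous fun z : ℝ × E => ‖gradient f z.2 - g‖ := by fun_prop
        refine h1.continuousAt.eventually_lt continuousAt_const ?_
        simpa [← hgdef] using hgpos
      filter_upwards [hT.eventually hlin, hclose] with z hz1 hz2 hs hfz
      refine lt_of_lt_of_le ?_ hfz
      have hdiff : z.2 - z.1 • gradient f z.2 - z.2 = -(z.1 • gradient f z.2) := by abel
      simp only [hdiff] at hz1
      have hfd : fderiv ℝ f x (-(z.1 • gradient f z.2)) = -(z.1 * inner ℝ g (gradient f z.2)) := by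
        rw [map_neg, map_smul, hgdef, inner_gradient_left, smul_eq_mul]
      rw [hfd, norm_neg, norm_smul, Real.norm_eq_abs, Real.norm_eq_abs, abs_of_pos hs] at hz1
      have hub := (abs_le.1 hz1).2
      have hinner : inner ℝ g (gradient f z.2) = ‖g‖ ^ 2 + inner ℝ g (gradient f z.2 - g) := by
        rw [inner_sub_right, real_inner_self_eq_norm_sq]; ring
      have hcs := (abs_le.1 (abs_real_inner_le_norm g (gradient f z.2 - g))).1
      have hnorm : ‖gradient f z.2‖ ≤ ‖g‖ + ‖gradient f z.2 - g‖ := by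
        simpa using norm_add_le g (gradient f z.2 - g)
      have h1 : 3 / 4 * ‖g‖ ^ 2 ≤ inner ℝ g (gradient f z.2) := by
        rw [hinner]; nlinarith
      have h2 : ‖g‖ / 4 * ‖gradient f z.2‖ ≤ 1 / 2 * ‖g‖ ^ 2 := by nlinarith
      have h3 : 0 < z.1 * (inner ℝ g (gradient f z.2) - ‖g‖ / 4 * ‖gradient f z.2‖) :=
        mul_pos hs (by nlinarith [pow_pos hgpos 2])
      linarith
  have h0 : ∀ᶠ s in 𝓝[>] (0 : ℝ), 0 < s ∧ ∀ x ∈ {x | f x ≤ c},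
      (0 < s → f x ≤ c → f (x - s • gradient f x) < c) :=
    eventually_mem_nhdsWithin.and (key.filter_mono nhdsWithin_le_nhds)
  obtain ⟨s, hs, h⟩ := h0.exists
  exact ⟨s, hs, fun x hx => h x hx hs hx⟩

/-- Finite-dimensional mountain pass theorem: two critical points separated by the level set
`{g = r}`, on which `f ≥ L`, force a critical point of value in `[L, M]` whenever they can be joined
inside `{f ≤ M}`. -/
theorem exists_critical_point_of_separated {f g : E → ℝ} (hf : ContDiff ℝ 1 f)
    (hK : ∀ c, IsCompact {x | f x ≤ c}) (hg : Continuous g) {r L M : ℝ}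
    (hL : ∀ x, g x = r → L ≤ f x) {w₀ w₁ : E} (h₀ : g w₀ < r) (h₁ : r < g w₁)
    (hw₀ : fderiv ℝ f w₀ = 0) (hw₁ : fderiv ℝ f w₁ = 0)
    {C : Set E} (hC : IsPreconnected C) (hC₀ : w₀ ∈ C) (hC₁ : w₁ ∈ C) (hM : ∀ x ∈ C, f x ≤ M) :
    ∃ w, fderiv ℝ f w = 0 ∧ L ≤ f w ∧ f w ≤ M := by
  -- Minimax over connected sets rather than paths: they still have to cross `{g = r}`, and
  -- continuous images of them are again connected.
  let A : Set ℝ := {m | ∃ S : Set E, IsPreconnected S ∧ w₀ ∈ S ∧ w₁ ∈ S ∧ ∀ x ∈ S, f x ≤ m}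
  have hMA : M ∈ A := ⟨C, hC, hC₀, hC₁, hM⟩
  have hLA : ∀ m ∈ A, L ≤ m := by
    rintro m ⟨S, hS, hS₀, hS₁, hm⟩
    obtain ⟨x, hx, hxr⟩ := hS.intermediate_value hS₀ hS₁ hg.continuousOn ⟨h₀.le, h₁.le⟩
    exact (hL x hxr).trans (hm x hx)
  have hbdd : BddBelow A := ⟨L, hLA⟩
  have hLc : L ≤ sInf A := le_csInf ⟨M, hMA⟩ hLA
  have hcM : sInf A ≤ M := csInf_le hbdd hMA
  generalize hcdef : sInf A = c at hLc hcM
  by_contra hcon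
  push Not at hcon
  have hgrad : Continuous (gradient f) :=
    (InnerProductSpace.toDual ℝ E).symm.continuous.comp (hf.continuous_fderiv one_ne_zero)
  obtain ⟨s, hs, hstep⟩ := exists_gradient_step_lt hf (hK c) (c := c) fun x hx h0 => by
    have hx0 : fderiv ℝ f x = 0 := by simpa [gradient] using h0
    have := hcon x hx0 (hx ▸ hLc)
    linarith
  have hη : Continuous fun x => x - s • gradient f x := by fun_prop
  have hfη : Continuous fun x => f (x - s • gradient f x) := hf.continuous.comp hη
  -- The points of `{f ≤ c + 1}` not pushed below `c` form a compact set on which `f > c`; half the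
  -- gap between its minimum and `c` serves as `τ`.
  obtain ⟨τ, hτ, hτstep⟩ : ∃ τ > 0, ∀ x, f x ≤ c + τ → f (x - s • gradient f x) < c := by
    have hB : IsCompact ({x | f x ≤ c + 1} ∩ {x | c ≤ f (x - s • gradient f x)}) :=
      (hK _).inter_right (isClosed_le continuous_const hfη)
    rcases Set.eq_empty_or_nonempty
      ({x | f x ≤ c + 1} ∩ {x | c ≤ f (x - s • gradient f x)}) with he | hne
    · refine ⟨1, one_pos, fun x hx => ?_⟩
      by_contra! hx'
      exact Set.eq_empty_iff_forall_notMem.1 he x ⟨hx, hx'⟩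
    · obtain ⟨y, ⟨hy1, hy2⟩, hymin⟩ := hB.exists_isMinOn hne hf.continuous.continuousOn
      have hyc : c < f y := by
        by_contra! h
        exact absurd (hstep y h) (not_lt.2 hy2)
      refine ⟨(f y - c) / 2, by linarith, fun x hx => ?_⟩
      by_contra! hx'
      have hy1' : f y ≤ c + 1 := hy1
      have : f y ≤ f x := hymin ⟨show f x ≤ c + 1 by linarith, hx'⟩
      linarith
  obtain ⟨m, ⟨S, hS, hS₀, hS₁, hm⟩, hmc⟩ :=
    exists_lt_of_csInf_lt ⟨M, hMA⟩ (show sInf A < c + τ by linarith)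
  have hne : {x | f x ≤ c + τ}.Nonempty := ⟨w₀, (hm w₀ hS₀).trans hmc.le⟩
  -- An attained maximum is a single bound strictly below `c` for the pushed set. That set still
  -- joins `w₀` to `w₁`, since critical points are fixed by the step; this contradicts `c = sInf A`.
  obtain ⟨y, hy, hymax⟩ := (hK (c + τ)).exists_isMaxOn hne hfη.continuousOn
  have hylt := hτstep y hy
  have hfix : ∀ w, fderiv ℝ f w = 0 → w - s • gradient f w = w := fun w hw => by
    simp [gradient, hw]
  have : f (y - s • gradient f y) ∈ A := by
    refine ⟨(fun x => x - s • gradient f x) '' S, hS.image _ hη.continuousOn,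
      ⟨w₀, hS₀, hfix _ hw₀⟩, ⟨w₁, hS₁, hfix _ hw₁⟩, ?_⟩
    rintro _ ⟨x, hx, rfl⟩
    exact hymax (show f x ≤ c + τ from (hm x hx).trans hmc.le)
  have := csInf_le hbdd this
  linarith

/-- If `f ≥ L` on `{g = r}` and `f u < L` for some `u` with `g u < r`, then `f` has a critical
point `w` with `g w < r` and `f w ≤ f u`. -/
theorem exists_critical_point_lt {E : Type*} [NormedAddCommGroup E] [NormedSpace ℝ E] {f g : E → ℝ} (hf : ContDiff ℝ 1 f)
    (hK : ∀ c, IsCompact {x | f x ≤ c}) (hg : Continuous g) {r L : ℝ}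
    (hL : ∀ x, g x = r → L ≤ f x) {u : E} (hu : g u < r) (hfu : f u < L) :
    ∃ w, fderiv ℝ f w = 0 ∧ g w < r ∧ f w ≤ f u := by
  have hc : IsCompact ({x | f x ≤ f u} ∩ {x | g x ≤ r}) :=
    (hK _).inter_right (isClosed_le hg continuous_const)
  obtain ⟨w, ⟨hw1, hw2⟩, hmin⟩ := hc.exists_isMinOn ⟨u, le_refl (f u), hu.le⟩ hf.continuous.continuousOn
  have hw1' : f w ≤ f u := hw1
  have hwr : g w < r := lt_of_le_of_ne hw2 fun h => by linarith [hL w h]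
  -- Near `w` the constraint `g < r` is automatic, and points with `f > f u` cannot beat `w`, so `w`
  -- is a free local minimum.
  refine ⟨w, IsLocalMin.fderiv_eq_zero ?_, hwr, hw1⟩
  filter_upwards [hg.continuousAt.eventually_lt continuousAt_const hwr] with x hx
  rcases le_total (f x) (f u) with h | h
  · exact hmin ⟨h, hx.le⟩
  · exact hw1'.trans h

/-- The first two critical points are minima on the two sides of `{g = r}`, separated by `g`; the
third is a mountain pass point, separated from them by its value, at least `L`. The convex set `C`
joins the minima and keeps the pass below `M`. -/
theorem exists_three_critical_points {f g : E → ℝ} (hf : ContDiff ℝ 1 f)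
    (hK : ∀ c, IsCompact {x | f x ≤ c}) (hg : Continuous g) {r L M : ℝ}
    (hL : ∀ x, g x = r → L ≤ f x) {u₀ u₁ : E} (h₀ : g u₀ < r) (h₁ : r < g u₁)
    (hu₀ : f u₀ < L) (hu₁ : f u₁ < L) {C : Set E} (hC : Convex ℝ C)
    (hC₀ : ∀ x, f x ≤ f u₀ → x ∈ C) (hC₁ : ∀ x, f x ≤ f u₁ → x ∈ C) (hM : ∀ x ∈ C, f x ≤ M) :
    ∃ w : Fin 3 → E, Function.Injective w ∧ ∀ k, fderiv ℝ f (w k) = 0 ∧ f (w k) ≤ M := by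
  obtain ⟨w₀, hw₀, hgw₀, hfw₀⟩ := exists_critical_point_lt hf hK hg hL h₀ hu₀
  obtain ⟨w₁, hw₁, hgw₁, hfw₁⟩ := exists_critical_point_lt (g := fun x => -g x) (r := -r) hf hK
    hg.neg (fun x hx => hL x (neg_injective hx)) (neg_lt_neg h₁) hu₁
  replace hgw₁ : r < g w₁ := neg_lt_neg_iff.1 hgw₁
  have m₀ := hC₀ _ hfw₀
  have m₁ := hC₁ _ hfw₁
  obtain ⟨w₂, hw₂, hLw₂, hMw₂⟩ := exists_critical_point_of_separated hf hK hg hL hgw₀ hgw₁ hw₀ hw₁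
    hC.isPreconnected m₀ m₁ hM
  have n₀₁ : w₀ ≠ w₁ := by rintro rfl; linarith
  have n₀₂ : w₀ ≠ w₂ := by rintro rfl; linarith
  have n₁₂ : w₁ ≠ w₂ := by rintro rfl; linarith
  refine ⟨![w₀, w₁, w₂], ?_, ?_⟩
  · intro i j hij
    fin_cases i <;> fin_cases j <;> simp_all
  · intro k
    fin_cases k
    · exact ⟨hw₀, hM _ m₀⟩
    · exact ⟨hw₁, hM _ m₁⟩
    · exact ⟨hw₂, hMw₂⟩

/-- A three critical points theorem for `J + lam P + ν Γ`, uniform for `lam` in a compact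
interval, where `Γ` is an arbitrary `C¹` perturbation. -/
theorem exists_three_critical_points_of_perturbation {J P Γ : E → ℝ} (hJ : ContDiff ℝ 1 J)
    (hP : ContDiff ℝ 1 P) (hΓ : ContDiff ℝ 1 Γ) {a b r : ℝ}
    (hK : ∀ lam ∈ Icc a b, ∀ c, IsCompact {x | J x + lam * P x ≤ c})
    {u₀ u₁ : E} (h₀ : P u₀ < r) (h₁ : r < P u₁)
    (hL : ∀ lam ∈ Icc a b, ∃ L, (∀ x, P x = r → L ≤ J x + lam * P x) ∧
      J u₀ + lam * P u₀ < L ∧ J u₁ + lam * P u₁ < L) :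
    ∃ R : ℝ, 0 < R ∧ ∀ lam ∈ Icc a b, ∃ δ : ℝ, 0 < δ ∧ ∀ ν ∈ Icc 0 δ,
      ∃ w : Fin 3 → E, Function.Injective w ∧
        ∀ k, fderiv ℝ (fun x => J x + lam * P x + ν * Γ x) (w k) = 0 ∧ ‖w k‖ < R := by
  rcases lt_or_ge b a with hab | hab
  · exact ⟨1, one_pos, fun lam hlam => absurd (hlam.1.trans hlam.2) (not_le.2 hab)⟩
  have ha : a ∈ Icc a b := ⟨le_rfl, hab⟩
  have hb : b ∈ Icc a b := ⟨hab, le_rfl⟩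
  -- Being affine in `lam`, the value lies between those at `a` and `b`, so two compact sublevel
  -- sets control the whole interval.
  have hmin : ∀ lam ∈ Icc a b, ∀ x, J x + a * P x ≤ J x + lam * P x ∨
      J x + b * P x ≤ J x + lam * P x := by
    intro lam hlam x
    rcases le_total 0 (P x) with h | h
    · left; nlinarith [hlam.1]
    · right; nlinarith [hlam.2]
  have hmax : ∀ lam ∈ Icc a b, ∀ x, J x + lam * P x ≤ max (J x + a * P x) (J x + b * P x) := by
    intro lam hlam x
    rcases le_total 0 (P x) with h | h
    · refine le_max_of_le_right ?_; nlinarith [hlam.2]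
    · refine le_max_of_le_left ?_; nlinarith [hlam.1]
  have hball : ∀ c, ∃ R : ℝ, 0 < R ∧ ∀ lam ∈ Icc a b, ∀ x, J x + lam * P x ≤ c → ‖x‖ < R := by
    intro c
    obtain ⟨R, hR, hsub⟩ := (((hK a ha c).union (hK b hb c)).isBounded).subset_ball_lt 0 0
    refine ⟨R, hR, fun lam hlam x hx => ?_⟩
    rw [← mem_ball_zero_iff]
    refine hsub ?_
    rcases hmin lam hlam x with h | h
    · exact Or.inl (h.trans hx)
    · exact Or.inr (h.trans hx)
  have hcont : Continuous fun x => max (J x + a * P x) (J x + b * P x) := by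
    have := hJ.continuous
    have := hP.continuous
    fun_prop
  let Q : E → ℝ := fun x => max (J x + a * P x) (J x + b * P x)
  -- The ball of radius `R₀` will contain both minima, and `M` bounds the unperturbed values on it.
  -- The margins `+ 1` here and in `M + 1` absorb twice the perturbation size `ε ≤ 1 / 2`.
  obtain ⟨R₀, hR₀, hsub₀⟩ := hball (max (Q u₀) (Q u₁) + 1)
  obtain ⟨M, hM⟩ := ((isCompact_closedBall (0 : E) R₀).image hcont).bddAbove
  replace hM : ∀ x ∈ Metric.closedBall (0 : E) R₀, Q x ≤ M := fun x hx =>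
    hM (mem_image_of_mem _ hx)
  obtain ⟨R, hR, hsub⟩ := hball (M + 1)
  refine ⟨R, hR, fun lam hlam => ?_⟩
  -- The cutoff makes the perturbation bounded, and it equals `1` on the ball of radius `R`, where
  -- the critical points turn out to lie.
  let χ : ContDiffBump (0 : E) := ⟨R, R + 1, hR, by linarith⟩
  have hχΓ : ContDiff ℝ 1 fun x => χ x * Γ x := χ.contDiff.mul hΓ
  obtain ⟨B, hB⟩ := (χ.hasCompactSupport.mul_right (f' := Γ)).exists_bound_of_continuous
    hχΓ.continuous
  replace hB : ∀ x, |χ x * Γ x| ≤ B := hB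
  have hB0 : 0 ≤ B := (abs_nonneg _).trans (hB 0)
  obtain ⟨L, hLr, hL₀, hL₁⟩ := hL lam hlam
  obtain ⟨ε, hε, hε1, hε₀, hε₁⟩ : ∃ ε : ℝ, 0 < ε ∧ ε ≤ 1 / 2 ∧ J u₀ + lam * P u₀ + ε < L - ε ∧
      J u₁ + lam * P u₁ + ε < L - ε := by
    refine ⟨min (1 / 2) (min ((L - (J u₀ + lam * P u₀)) / 3) ((L - (J u₁ + lam * P u₁)) / 3)),
      ?_, min_le_left _ _, ?_, ?_⟩
    · refine lt_min (by norm_num) (lt_min ?_ ?_) <;> linarith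
    · have := (min_le_right (1 / 2) (min ((L - (J u₀ + lam * P u₀)) / 3)
        ((L - (J u₁ + lam * P u₁)) / 3))).trans (min_le_left _ _)
      linarith
    · have := (min_le_right (1 / 2) (min ((L - (J u₀ + lam * P u₀)) / 3)
        ((L - (J u₁ + lam * P u₁)) / 3))).trans (min_le_right _ _)
      linarith
  refine ⟨ε / (B + 1), by positivity, fun ν hν => ?_⟩
  have hpert : ∀ x, |ν * (χ x * Γ x)| ≤ ε := by
    intro x
    rw [abs_mul, abs_of_nonneg hν.1]
    have h2 : ν * (B + 1) ≤ ε := (le_div_iff₀ (by positivity)).1 hν.2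
    nlinarith [hB x, hν.1]
  let f : E → ℝ := fun x => J x + lam * P x + ν * (χ x * Γ x)
  have hlow : ∀ x, J x + lam * P x ≤ f x + ε := fun x => by
    have := (abs_le.1 (hpert x)).1
    simp only [f]; linarith
  have hupp : ∀ x, f x ≤ J x + lam * P x + ε := fun x => by
    have := (abs_le.1 (hpert x)).2
    simp only [f]; linarith
  have hf : ContDiff ℝ 1 f := (hJ.add (contDiff_const.mul hP)).add (contDiff_const.mul hχΓ)
  have hfK : ∀ c, IsCompact {x | f x ≤ c} := fun c =>
    (hK lam hlam (c + ε)).of_isClosed_subset (isClosed_le hf.continuous continuous_const)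
      fun x (hx : f x ≤ c) => show J x + lam * P x ≤ c + ε by linarith [hlow x]
  obtain ⟨w, hw, hwk⟩ := exists_three_critical_points (L := L - ε) (M := M + ε)
    (C := Metric.closedBall (0 : E) R₀) hf hfK hP.continuous
    (fun x hx => by linarith [hLr x hx, hlow x]) h₀ h₁ (by linarith [hupp u₀])
    (by linarith [hupp u₁]) (convex_closedBall _ _)
    (fun x hx => by
      rw [mem_closedBall_zero_iff]
      refine (hsub₀ lam hlam x ?_).le
      have : J u₀ + lam * P u₀ ≤ max (Q u₀) (Q u₁) :=
        (hmax lam hlam u₀).trans (le_max_left (Q u₀) (Q u₁))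
      linarith [hlow x, hupp u₀])
    (fun x hx => by
      rw [mem_closedBall_zero_iff]
      refine (hsub₀ lam hlam x ?_).le
      have : J u₁ + lam * P u₁ ≤ max (Q u₀) (Q u₁) :=
        (hmax lam hlam u₁).trans (le_max_right (Q u₀) (Q u₁))
      linarith [hlow x, hupp u₁])
    (fun x hx => by
      have h1 : J x + lam * P x ≤ Q x := hmax lam hlam x
      linarith [hM x hx, hupp x])
  refine ⟨w, hw, fun k => ?_⟩
  have hwR : ‖w k‖ < R := hsub lam hlam _ (by linarith [hlow (w k), (hwk k).2])
  refine ⟨?_, hwR⟩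
  rw [← (hwk k).1]
  refine Filter.EventuallyEq.fderiv_eq ?_
  filter_upwards [Metric.isOpen_ball.mem_nhds (mem_ball_zero_iff.2 hwR)] with x hx
  simp only [f]
  rw [χ.one_of_mem_closedBall (Metric.ball_subset_closedBall hx), one_mul]

end MountainPass

namespace PhiLaplacian

variable {N T : ℕ}

/-! ### Periodic sequences and summation by parts. -/

section Periodic

theorem exists_mem_Icc_of_periodic {α : Type*} {p : ℤ → α} (hT : 0 < T)
    (hp : ∀ t : ℤ, p (t + (T : ℤ)) = p t) (t : ℤ) :
    ∃ s ∈ Finset.Icc (1 : ℤ) T, p t = p s := by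
  have hT' : (0 : ℤ) < T := by exact_mod_cast hT
  refine ⟨(t - 1) % T + 1, ?_, ?_⟩
  · have h1 := Int.emod_nonneg (t - 1) hT'.ne'
    have h2 := Int.emod_lt_of_pos (t - 1) hT'
    rw [Finset.mem_Icc]
    omega
  · have hper : Function.Periodic p (T : ℤ) := hp
    have h := hper.int_mul ((t - 1) / T) ((t - 1) % T + 1)
    rw [← h]
    congr 1
    have := Int.emod_add_mul_ediv (t - 1) T
    rw [Int.cast_id]
    linarith

theorem sum_Icc_sub_eq (q : ℤ → ℝ) (n : ℕ) :
    ∑ t ∈ Finset.Icc (1 : ℤ) n, (q t - q (t - 1)) = q n - q 0 := by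
  induction n with
  | zero => simp
  | succ n ih =>
    have : Finset.Icc (1 : ℤ) ((n + 1 : ℕ) : ℤ) = insert ((n : ℤ) + 1) (Finset.Icc (1 : ℤ) n) := by
      ext t
      simp only [Finset.mem_Icc, Finset.mem_insert]
      omega
    rw [this, Finset.sum_insert (by simp), ih]
    simp

/-- Summation by parts: the difference of the two sides telescopes through `⟨a t, v (t + 1)⟩`, and
periodicity cancels the boundary terms. -/
theorem sum_inner_fdiff {a v : ℤ → Vec N} (ha : ∀ t : ℤ, a (t + (T : ℤ)) = a t)
    (hv : ∀ t : ℤ, v (t + (T : ℤ)) = v t) :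
    ∑ t ∈ Finset.Icc (1 : ℤ) T, inner ℝ (a t) (fdiff v t) =
      -∑ t ∈ Finset.Icc (1 : ℤ) T, inner ℝ (fdiff (fun s => a (s - 1)) t) (v t) := by
  rw [eq_neg_iff_add_eq_zero, ← Finset.sum_add_distrib]
  have h := sum_Icc_sub_eq (fun t => inner ℝ (a t) (v (t + 1))) T
  have h0 : a T = a 0 := by simpa using ha 0
  have h1 : v ((T : ℤ) + 1) = v (0 + 1) := by simpa [add_comm] using hv 1
  rw [h0, h1, sub_self] at h
  rw [← h]
  refine Finset.sum_congr rfl fun t _ => ?_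
  simp only [fdiff, inner_sub_right, inner_sub_left, add_sub_cancel_right, sub_add_cancel]
  ring

theorem fdiff_periodic {h : ℤ → Vec N} (hh : ∀ t : ℤ, h (t + (T : ℤ)) = h t) (t : ℤ) :
    fdiff h (t + (T : ℤ)) = fdiff h t := by
  simp only [fdiff]
  rw [add_right_comm, hh, hh]

/-- Restriction of a periodic sequence to one period. -/
def restrictPeriod (N T : ℕ) : PerSeq N T →ₗ[ℝ] (Finset.Icc (1 : ℤ) T → Vec N) :=
  (LinearMap.funLeft ℝ (Vec N) (Subtype.val : Finset.Icc (1 : ℤ) T → ℤ)).comp (PerSeq N T).subtype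

theorem restrictPeriod_injective (hT : 0 < T) : Function.Injective (restrictPeriod N T) := by
  intro h k hhk
  ext1
  funext t
  obtain ⟨s, hs, hp⟩ := exists_mem_Icc_of_periodic (p := fun t => (h.1 t, k.1 t)) hT
    (fun t => Prod.ext (h.2 t) (k.2 t)) t
  rw [Prod.ext_iff] at hp
  exact hp.1.trans ((congrFun hhk ⟨s, hs⟩).trans hp.2.symm)

theorem finiteDimensional_perSeq (hT : 0 < T) : FiniteDimensional ℝ (PerSeq N T) :=
  FiniteDimensional.of_injective _ (restrictPeriod_injective hT)

/-- Restriction of a pair of periodic sequences to one period. -/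
def restrictPair (N T : ℕ) : PerPair N T →ₗ[ℝ]
    (Finset.Icc (1 : ℤ) T → Vec N) × (Finset.Icc (1 : ℤ) T → Vec N) :=
  (restrictPeriod N T).prodMap (restrictPeriod N T)

theorem restrictPair_injective (hT : 0 < T) : Function.Injective (restrictPair N T) :=
  (restrictPeriod_injective hT).prodMap (restrictPeriod_injective hT)

end Periodic

/-! ### Smoothness of the functionals in linear coordinates. -/

section Regularity

variable {E : Type*} [NormedAddCommGroup E] [NormedSpace ℝ E] [FiniteDimensional ℝ E]
  (e : E →ₗ[ℝ] PerPair N T)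

theorem contDiff_fst_apply (t : ℤ) : ContDiff ℝ 1 fun x => (e x).1.1 t :=
  (LinearMap.toContinuousLinearMap ((LinearMap.proj t).comp
    ((PerSeq N T).subtype.comp ((LinearMap.fst ℝ _ _).comp e)))).contDiff

theorem contDiff_snd_apply (t : ℤ) : ContDiff ℝ 1 fun x => (e x).2.1 t :=
  (LinearMap.toContinuousLinearMap ((LinearMap.proj t).comp
    ((PerSeq N T).subtype.comp ((LinearMap.snd ℝ _ _).comp e)))).contDiff

theorem contDiff_funI {ρ : Fin 4 → ℤ → ℝ} {Φ : Fin 4 → Vec N → ℝ}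
    (hΦ : ∀ i, ContDiff ℝ 1 (Φ i)) : ContDiff ℝ 1 fun x => funI ρ Φ (e x) := by
  have h1 := contDiff_fst_apply e
  have h2 := contDiff_snd_apply e
  refine ContDiff.sum fun t _ => ?_
  exact (((contDiff_const.mul ((hΦ 0).comp ((h1 (t + 1)).sub (h1 t)))).add
    (contDiff_const.mul ((hΦ 1).comp ((h2 (t + 1)).sub (h2 t))))).add
    (contDiff_const.mul ((hΦ 2).comp (h1 t)))).add
    (contDiff_const.mul ((hΦ 3).comp (h2 t)))

theorem contDiff_funSum {K : ℤ → Vec N → Vec N → ℝ} (hK : CondA2 T K) :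
    ContDiff ℝ 1 fun x => funSum K (e x) :=
  ContDiff.sum fun t ht =>
    (hK.2 t ht).comp ((contDiff_fst_apply e t).prodMk (contDiff_snd_apply e t))

theorem continuous_normPair {θ : ℝ} (hθ : 0 < θ) : Continuous fun x => normPair θ (e x) := by
  have h1 := fun t => (contDiff_fst_apply e t).continuous
  have h2 := fun t => (contDiff_snd_apply e t).continuous
  have hpow : ∀ f : E → Vec N, Continuous f → Continuous fun x => ‖f x‖ ^ θ := fun f hf =>
    hf.norm.rpow_const fun _ => Or.inr hθ.le
  have hθ' : 0 ≤ 1 / θ := by positivity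
  refine Continuous.add ?_ ?_
  · refine Continuous.rpow_const ?_ fun _ => Or.inr hθ'
    exact (continuous_finsetSum _ fun t _ => hpow _ ((h1 (t + 1)).sub (h1 t))).add
      (continuous_finsetSum _ fun t _ => hpow _ (h1 t))
  · refine Continuous.rpow_const ?_ fun _ => Or.inr hθ'
    exact (continuous_finsetSum _ fun t _ => hpow _ ((h2 (t + 1)).sub (h2 t))).add
      (continuous_finsetSum _ fun t _ => hpow _ (h2 t))

end Regularity

/-! ### From critical points to the difference system. -/

section EulerLagrange

theorem hasDerivAt_line_of_hasGradientAt {f : Vec N → ℝ} {p x : Vec N} (hf : HasGradientAt f p x)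
    (y : Vec N) : HasDerivAt (fun s : ℝ => f (x + s • y)) (inner ℝ p y) 0 := by
  have hl : HasDerivAt (fun s : ℝ => x + s • y) y 0 := by
    simpa using ((hasDerivAt_id (0 : ℝ)).smul_const y).const_add x
  have hf' : HasFDerivAt f (InnerProductSpace.toDual ℝ (Vec N) p) (x + (0 : ℝ) • y) := by
    simpa using hf.hasFDerivAt
  exact hf'.comp_hasDerivAt (f := fun s : ℝ => x + s • y) (0 : ℝ) hl

theorem hasDerivAt_line_of_contDiff {K : Vec N → Vec N → ℝ}
    (hK : ContDiff ℝ 1 fun x : Vec N × Vec N => K x.1 x.2) (x₁ x₂ y₁ y₂ : Vec N) :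
    HasDerivAt (fun s : ℝ => K (x₁ + s • y₁) (x₂ + s • y₂))
      (inner ℝ (gradient (fun x => K x x₂) x₁) y₁ +
        inner ℝ (gradient (fun x => K x₁ x) x₂) y₂) 0 := by
  set D := fderiv ℝ (fun x : Vec N × Vec N => K x.1 x.2) (x₁, x₂)
  have hd : HasFDerivAt (fun x : Vec N × Vec N => K x.1 x.2) D (x₁, x₂) :=
    (hK.differentiable one_ne_zero (x₁, x₂)).hasFDerivAt
  have hl : HasDerivAt (fun s : ℝ => (x₁ + s • y₁, x₂ + s • y₂)) (y₁, y₂) 0 := by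
    have hl' : ∀ x y : Vec N, HasDerivAt (fun s : ℝ => x + s • y) y 0 := fun x y => by
      simpa using ((hasDerivAt_id (0 : ℝ)).smul_const y).const_add x
    exact (hl' x₁ y₁).prodMk (hl' x₂ y₂)
  have h1 : HasFDerivAt (fun x => K x x₂) (D.comp (ContinuousLinearMap.inl ℝ _ _)) x₁ :=
    HasFDerivAt.comp (g := fun x : Vec N × Vec N => K x.1 x.2) (f := fun x => (x, x₂)) x₁ hd
      (hasFDerivAt_prodMk_left x₁ x₂)
  have h2 : HasFDerivAt (fun x => K x₁ x) (D.comp (ContinuousLinearMap.inr ℝ _ _)) x₂ :=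
    HasFDerivAt.comp (g := fun x : Vec N × Vec N => K x.1 x.2) (f := fun x => (x₁, x)) x₂ hd
      (hasFDerivAt_prodMk_right x₁ x₂)
  have hsum : inner ℝ (gradient (fun x => K x x₂) x₁) y₁ +
      inner ℝ (gradient (fun x => K x₁ x) x₂) y₂ = D (y₁, y₂) := by
    rw [inner_gradient_left, inner_gradient_left, h1.fderiv, h2.fderiv]
    simp [← map_add]
  rw [hsum]
  have hd' : HasFDerivAt (fun x : Vec N × Vec N => K x.1 x.2) D
      (x₁ + (0 : ℝ) • y₁, x₂ + (0 : ℝ) • y₂) := by simpa using hd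
  exact hd'.comp_hasDerivAt (f := fun s : ℝ => (x₁ + s • y₁, x₂ + s • y₂)) (0 : ℝ) hl

theorem fdiff_add_smul (h k : ℤ → Vec N) (s : ℝ) (t : ℤ) :
    fdiff (h + s • k) t = fdiff h t + s • fdiff k t := by
  simp only [fdiff, Pi.add_apply, Pi.smul_apply, smul_sub]
  abel

theorem hasDerivAt_funI {ρ : Fin 4 → ℤ → ℝ} {φ : Fin 4 → Vec N → Vec N}
    {Φ : Fin 4 → Vec N → ℝ} (hΦ : ∀ i x, HasGradientAt (Φ i) (φ i x) x) (u v : PerPair N T) :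
    HasDerivAt (fun s : ℝ => funI ρ Φ (u + s • v))
      (∑ t ∈ Finset.Icc (1 : ℤ) T,
        (ρ 0 t * inner ℝ (φ 0 (fdiff u.1.1 t)) (fdiff v.1.1 t) +
          ρ 1 t * inner ℝ (φ 1 (fdiff u.2.1 t)) (fdiff v.2.1 t) +
          ρ 2 t * inner ℝ (φ 2 (u.1.1 t)) (v.1.1 t) +
          ρ 3 t * inner ℝ (φ 3 (u.2.1 t)) (v.2.1 t))) 0 := by
  refine HasDerivAt.fun_sum fun t _ => ?_
  have h0 := hasDerivAt_line_of_hasGradientAt (hΦ 0 (fdiff u.1.1 t)) (fdiff v.1.1 t)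
  have h1 := hasDerivAt_line_of_hasGradientAt (hΦ 1 (fdiff u.2.1 t)) (fdiff v.2.1 t)
  have h2 := hasDerivAt_line_of_hasGradientAt (hΦ 2 (u.1.1 t)) (v.1.1 t)
  have h3 := hasDerivAt_line_of_hasGradientAt (hΦ 3 (u.2.1 t)) (v.2.1 t)
  simp only [← fdiff_add_smul] at h0 h1
  exact (((h0.const_mul _).add (h1.const_mul _)).add (h2.const_mul _)).add (h3.const_mul _)

theorem hasDerivAt_funSum {K : ℤ → Vec N → Vec N → ℝ} (hK : CondA2 T K) (u v : PerPair N T) :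
    HasDerivAt (fun s : ℝ => funSum K (u + s • v))
      (∑ t ∈ Finset.Icc (1 : ℤ) T,
        (inner ℝ (gradient (fun x => K t x (u.2.1 t)) (u.1.1 t)) (v.1.1 t) +
          inner ℝ (gradient (fun x => K t (u.1.1 t) x) (u.2.1 t)) (v.2.1 t))) 0 :=
  HasDerivAt.fun_sum fun t ht =>
    hasDerivAt_line_of_contDiff (hK.2 t ht) (u.1.1 t) (u.2.1 t) (v.1.1 t) (v.2.1 t)

/-- Critical points of `μ I - ∑ W` solve the difference system. -/
theorem isSolution_of_hasDerivAt_zero {ρ : Fin 4 → ℤ → ℝ} {φ : Fin 4 → Vec N → Vec N}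
    {Φ : Fin 4 → Vec N → ℝ} {W : ℤ → Vec N → Vec N → ℝ} {μ : ℝ} (hT : 0 < T)
    (hρ : ∀ i, ∀ t : ℤ, ρ i (t + (T : ℤ)) = ρ i t)
    (hΦ : ∀ i x, HasGradientAt (Φ i) (φ i x) x) (hW : CondA2 T W) {u : PerPair N T}
    (hu : ∀ v, HasDerivAt (fun s : ℝ => μ * funI ρ Φ (u + s • v) - funSum W (u + s • v)) 0 0) :
    IsSolution ρ φ W μ u := by
  have hW1 : ∀ t : ℤ, W (t + (T : ℤ)) = W t := fun t => funext₂ (hW.1 t)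
  have hu1 := u.1.2
  have hu2 := u.2.2
  have hperiodic : ∀ (i : Fin 4) (h : PerSeq N T) (t : ℤ),
      ρ i (t + (T : ℤ)) • φ i (fdiff h.1 (t + (T : ℤ))) = ρ i t • φ i (fdiff h.1 t) := by
    intro i h t
    rw [hρ, fdiff_periodic h.2]
  have hshift : ∀ (i : Fin 4) (h : PerSeq N T) (t : ℤ),
      fdiff (fun s => ρ i (s - 1) • φ i (fdiff h.1 (s - 1))) (t + (T : ℤ)) =
        fdiff (fun s => ρ i (s - 1) • φ i (fdiff h.1 (s - 1))) t := by
    intro i h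
    refine fdiff_periodic fun t => ?_
    rw [add_sub_right_comm]
    exact hperiodic i h (t - 1)
  -- `A₁` and `A₂` are the residuals of the two equations; being periodic, they are themselves
  -- admissible test sequences.
  let A₁ : ℤ → Vec N := fun t =>
    μ • fdiff (fun s => ρ 0 (s - 1) • φ 0 (fdiff u.1.1 (s - 1))) t
      - (μ * ρ 2 t) • φ 2 (u.1.1 t) + gradient (fun x => W t x (u.2.1 t)) (u.1.1 t)
  let A₂ : ℤ → Vec N := fun t =>
    μ • fdiff (fun s => ρ 1 (s - 1) • φ 1 (fdiff u.2.1 (s - 1))) t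
      - (μ * ρ 3 t) • φ 3 (u.2.1 t) + gradient (fun x => W t (u.1.1 t) x) (u.2.1 t)
  have hA₁ : ∀ t : ℤ, A₁ (t + (T : ℤ)) = A₁ t := fun t => by
    simp only [A₁]
    rw [hshift 0 u.1 t, hρ, hu1 t, hu2 t, hW1 t]
  have hA₂ : ∀ t : ℤ, A₂ (t + (T : ℤ)) = A₂ t := fun t => by
    simp only [A₂]
    rw [hshift 1 u.2 t, hρ, hu1 t, hu2 t, hW1 t]
  have hweak : ∀ v : PerPair N T, ∑ t ∈ Finset.Icc (1 : ℤ) T,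
      (inner ℝ (A₁ t) (v.1.1 t) + inner ℝ (A₂ t) (v.2.1 t)) = 0 := by
    intro v
    have hd := (((hasDerivAt_funI hΦ u v).const_mul μ).sub (hasDerivAt_funSum hW u v)).unique (hu v)
    have hp1 := sum_inner_fdiff (a := fun t => ρ 0 t • φ 0 (fdiff u.1.1 t))
      (hperiodic 0 u.1) v.1.2
    have hp2 := sum_inner_fdiff (a := fun t => ρ 1 t • φ 1 (fdiff u.2.1 t))
      (hperiodic 1 u.2) v.2.2
    simp only [inner_smul_left, conj_trivial] at hp1 hp2
    simp only [A₁, A₂, inner_add_left, inner_sub_left, inner_smul_left, conj_trivial,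
      Finset.sum_add_distrib, Finset.sum_sub_distrib, mul_assoc, ← Finset.mul_sum] at hd ⊢
    rw [hp1, hp2] at hd
    linarith
  -- Testing with the residuals gives a vanishing sum of squares over one period.
  have hzero := hweak (⟨A₁, hA₁⟩, ⟨A₂, hA₂⟩)
  rw [Finset.sum_eq_zero_iff_of_nonneg fun t _ =>
    add_nonneg real_inner_self_nonneg real_inner_self_nonneg] at hzero
  intro t
  obtain ⟨s, hs, hts⟩ := exists_mem_Icc_of_periodic (p := fun t => (A₁ t, A₂ t)) hT
    (fun t => Prod.ext (hA₁ t) (hA₂ t)) t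
  rw [Prod.ext_iff] at hts
  have h0 := hzero s hs
  rw [add_eq_zero_iff_of_nonneg real_inner_self_nonneg real_inner_self_nonneg,
    inner_self_eq_zero, inner_self_eq_zero] at h0
  exact ⟨hts.1.trans h0.1, hts.2.trans h0.2⟩

end EulerLagrange

/-! ### Compactness of sublevel sets. -/

section Coercivity

/-- This lower bound leaves coercivity to `μI`; at `lam = 1` it also makes `γ` a genuine lower
bound. -/
theorem exists_le_funPsi_add_funPhi {F G : ℤ → Vec N → Vec N → ℝ} {l lam : ℝ}
    (hFG : CondA5 T F G l) (hlam : 0 < lam) :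
    ∃ C : ℝ, ∀ u : PerPair N T, C ≤ funPsi F u + lam * funPhi G u := by
  have : ∀ t : ℤ, ∃ C : ℝ, t ∈ Finset.Icc (1 : ℤ) T →
      ∀ x₁ x₂ : Vec N, F t x₁ x₂ + C ≤ lam * G t x₁ x₂ := by
    intro t
    by_cases ht : t ∈ Finset.Icc (1 : ℤ) T
    · obtain ⟨C, hC⟩ := (hFG t ht).2 lam hlam
      exact ⟨C, fun _ => hC⟩
    · exact ⟨0, fun h => absurd h ht⟩
  choose C hC using this
  refine ⟨∑ t ∈ Finset.Icc (1 : ℤ) T, C t, fun u => ?_⟩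
  have h := Finset.sum_le_sum fun t ht => hC t ht (u.1.1 t) (u.2.1 t)
  rw [Finset.sum_add_distrib, ← Finset.mul_sum] at h
  simp only [funPsi, funPhi, funSum]
  linarith

variable {ρ : Fin 4 → ℤ → ℝ} {Φ : Fin 4 → Vec N → ℝ}

theorem funI_summand_nonneg (hρ : CondRho T ρ) (hΦ : ∀ i x, 0 ≤ Φ i x) (u : PerPair N T)
    {t : ℤ} (ht : t ∈ Finset.Icc (1 : ℤ) T) :
    0 ≤ ρ 0 t * Φ 0 (fdiff u.1.1 t) + ρ 1 t * Φ 1 (fdiff u.2.1 t)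
      + ρ 2 t * Φ 2 (u.1.1 t) + ρ 3 t * Φ 3 (u.2.1 t) := by
  have h : ∀ i x, 0 ≤ ρ i t * Φ i x := fun i x => mul_nonneg ((hρ i).2 t ht).le (hΦ i x)
  exact add_nonneg (add_nonneg (add_nonneg (h _ _) (h _ _)) (h _ _)) (h _ _)

theorem funI_nonneg (hρ : CondRho T ρ) (hΦ : ∀ i x, 0 ≤ Φ i x) (u : PerPair N T) :
    0 ≤ funI ρ Φ u :=
  Finset.sum_nonneg fun _ ht => funI_summand_nonneg hρ hΦ u ht

theorem le_funI (hρ : CondRho T ρ) (hΦ : ∀ i x, 0 ≤ Φ i x) (u : PerPair N T)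
    {t : ℤ} (ht : t ∈ Finset.Icc (1 : ℤ) T) :
    ρ 2 t * Φ 2 (u.1.1 t) ≤ funI ρ Φ u ∧ ρ 3 t * Φ 3 (u.2.1 t) ≤ funI ρ Φ u := by
  have h : ∀ i x, 0 ≤ ρ i t * Φ i x := fun i x => mul_nonneg ((hρ i).2 t ht).le (hΦ i x)
  have hle := Finset.single_le_sum (fun s hs => funI_summand_nonneg hρ hΦ u hs) ht
  have h0 := h 0 (fdiff u.1.1 t)
  have h1 := h 1 (fdiff u.2.1 t)
  have h2 := h 2 (u.1.1 t)
  have h3 := h 3 (u.2.1 t)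
  change _ ≤ funI ρ Φ u at hle
  constructor <;> linarith

theorem isCompact_sublevel_of_tendsto {f : Vec N → ℝ} (hf : Continuous f)
    (hcoer : Tendsto f (comap (fun x : Vec N => ‖x‖) atTop) atTop) (d : ℝ) :
    IsCompact {x | f x ≤ d} := by
  have hc : Tendsto f (cocompact (Vec N)) atTop := by
    rwa [← Metric.cobounded_eq_cocompact, ← comap_norm_atTop]
  obtain ⟨K, hK, hsub⟩ := mem_cocompact.1 (hc.eventually (eventually_gt_atTop d))
  refine hK.of_isClosed_subset (isClosed_le hf continuous_const) fun x hx => ?_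
  by_contra hxK
  exact absurd (show d < f x from hsub hxK) (not_lt.2 hx)

/-- On a sublevel set `I` is bounded, because `Ψ + lam Φ` is bounded below. All terms of `I` are
nonnegative, so each `u₁(t)`, `u₂(t)` stays in a compact sublevel set of `Φ 2`, `Φ 3`. Restriction
to one period is a closed embedding, which pulls compactness back. -/
theorem isCompact_sublevel {E : Type*} [NormedAddCommGroup E] [NormedSpace ℝ E]
    [FiniteDimensional ℝ E] {e : E →ₗ[ℝ] PerPair N T} (he : Function.Injective e) (hT : 0 < T)
    {F G : ℤ → Vec N → Vec N → ℝ} {l lam μ : ℝ} (hρ : CondRho T ρ)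
    (hΦ : ∀ i x, 0 ≤ Φ i x) (hΦc : ∀ i, ContDiff ℝ 1 (Φ i))
    (hcoer : ∀ i, Tendsto (Φ i) (comap (fun x : Vec N => ‖x‖) atTop) atTop)
    (hF : CondA2 T F) (hG : CondA2 T G) (hFG : CondA5 T F G l) (hlam : 0 < lam) (hμ : 0 < μ)
    (c : ℝ) :
    IsCompact {x | μ * funI ρ Φ (e x) + funPsi F (e x) + lam * funPhi G (e x) ≤ c} := by
  obtain ⟨C, hC⟩ := exists_le_funPsi_add_funPhi hFG hlam
  have hemb := LinearMap.isClosedEmbedding_of_injective (f := (restrictPair N T).comp e)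
    (LinearMap.ker_eq_bot.2 ((restrictPair_injective hT).comp he))
  have hcomp : ∀ i, IsCompact (Set.univ.pi fun t : Finset.Icc (1 : ℤ) T =>
      {x : Vec N | Φ i x ≤ (c - C) / μ / ρ i t}) := fun i =>
    isCompact_univ_pi fun t => isCompact_sublevel_of_tendsto (hΦc i).continuous (hcoer i) _
  refine (hemb.isCompact_preimage ((hcomp 2).prod (hcomp 3))).of_isClosed_subset ?_ fun x hx => ?_
  · refine isClosed_le ?_ continuous_const
    exact ((continuous_const.mul (contDiff_funI e hΦc).continuous).add
      (contDiff_funSum e hF).continuous.neg).add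
      (continuous_const.mul (contDiff_funSum e hG).continuous)
  · have hx' : μ * funI ρ Φ (e x) + funPsi F (e x) + lam * funPhi G (e x) ≤ c := hx
    have hI : funI ρ Φ (e x) ≤ (c - C) / μ := by
      rw [le_div_iff₀ hμ]
      linarith [hC (e x)]
    refine ⟨fun t _ => ?_, fun t _ => ?_⟩
    · exact (le_div_iff₀' ((hρ 2).2 t t.2)).2 ((le_funI hρ hΦ (e x) t.2).1.trans hI)
    · exact (le_div_iff₀' ((hρ 3).2 t t.2)).2 ((le_funI hρ hΦ (e x) t.2).2.trans hI)

end Coercivity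

/-! ### Meaning of the thresholds `μ*` and `β`. -/

section Levels

variable {X : Type} {I Ψ P : X → ℝ} {r μ : ℝ}

/-- A parameter above `μ*` produces a point of `{P < r}` at which `μ I + Ψ` stays below some
lower bound of its values on `{P = r}`. -/
theorem exists_lt_level_of_muStar_lt (hI : ∀ u, 0 ≤ I u)
    (hbdd : BddBelow (range fun u => Ψ u + P u)) (hμ : 0 < μ)
    (hmu : muStar I Ψ P r < (μ : EReal)) :
    ∃ u L, P u < r ∧ μ * I u + Ψ u < L ∧ ∀ v, P v = r → L ≤ μ * I v + Ψ v := by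
  simp only [muStar, iInf_lt_iff, EReal.coe_lt_coe_iff] at hmu
  obtain ⟨u, ⟨hur, hIu⟩, hlt⟩ := hmu
  rw [div_lt_iff₀ (sub_pos.2 hIu)] at hlt
  -- On `{P = r}` one has `I ≥ η_r` and `Ψ ≥ γ - r`, whence this bound.
  refine ⟨u, μ * etaInf I P r + gammaInf Ψ P - r, hur, by linarith, fun v hv => ?_⟩
  have h1 : gammaInf Ψ P ≤ Ψ v + P v := csInf_le hbdd ⟨v, rfl⟩
  have h2 : etaInf I P r ≤ I v :=
    csInf_le ⟨0, by rintro _ ⟨w, -, rfl⟩; exact hI w⟩ ⟨v, hv, rfl⟩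
  have h3 := mul_le_mul_of_nonneg_left h2 hμ.le
  linarith

/-- A parameter below `β` produces a point of `{P > r}` at which `J + b (P - r)` stays below the
infimum of `J` on `{P ≤ r}`. -/
theorem exists_lt_sInf_of_lt_beta {J : X → ℝ} {b : ℝ} (hb : (b : EReal) < beta J P r) :
    ∃ u, r < P u ∧ J u + b * (P u - r) < sInf (J '' {x | P x ≤ r}) := by
  simp only [beta, lt_iSup_iff, EReal.coe_lt_coe_iff] at hb
  obtain ⟨u, hu, hlt⟩ := hb
  refine ⟨u, hu, ?_⟩
  rw [lt_div_iff_of_neg (sub_neg.2 hu)] at hlt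
  linarith

end Levels

/-! ### The potential `W` and the final assembly. -/

theorem condA2_potW {F G H : ℤ → Vec N → Vec N → ℝ} (hF : CondA2 T F) (hG : CondA2 T G)
    (hH : CondA2 T H) (lam ν : ℝ) : CondA2 T (potW F G H lam ν) := by
  refine ⟨fun t x₁ x₂ => ?_, fun t ht => ?_⟩
  · simp only [potW, hF.1 t, hG.1 t, hH.1 t]
  · exact ((hF.2 t ht).sub (contDiff_const.mul (hG.2 t ht))).add (contDiff_const.mul (hH.2 t ht))

theorem funSum_potW (F G H : ℤ → Vec N → Vec N → ℝ) (lam ν : ℝ) (u : PerPair N T) :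
    funSum (potW F G H lam ν) u = funSum F u - lam * funSum G u + ν * funSum H u := by
  simp only [funSum, potW, Finset.sum_add_distrib, Finset.sum_sub_distrib, Finset.mul_sum]

end PhiLaplacian

open PhiLaplacian in
theorem theorem1p1 (N T : ℕ) (hN : 0 < N) (hT : 1 < T)
    (ρ : Fin 4 → ℤ → ℝ)
    (φ : Fin 4 → PhiLaplacian.Vec N → PhiLaplacian.Vec N)
    (Φ : Fin 4 → PhiLaplacian.Vec N → ℝ)
    (F G H : ℤ → PhiLaplacian.Vec N → PhiLaplacian.Vec N → ℝ)
    (θ l : ℝ)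
    (hρ : PhiLaplacian.CondRho T ρ)
    (hA1 : PhiLaplacian.CondA1 φ Φ)
    (hF : PhiLaplacian.CondA2 T F)
    (hG : PhiLaplacian.CondA2 T G)
    (hH : PhiLaplacian.CondA2 T H)
    (hA3 : PhiLaplacian.CondA3 φ θ)
    (hA4 : PhiLaplacian.CondA4 Φ θ l)
    (hA5 : PhiLaplacian.CondA5 T F G l)
    (hA6 : PhiLaplacian.CondA6 T G) :
    ∀ r : ℝ, 0 < r →
    ∀ μ : ℝ,
      max 0 (PhiLaplacian.muStar (X := PhiLaplacian.PerPair N T)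
        (PhiLaplacian.funI ρ Φ) (PhiLaplacian.funPsi F) (PhiLaplacian.funPhi G) r)
        < (μ : EReal) →
    ∀ a b : ℝ, a ≤ b → 0 < a →
      (b : EReal) < PhiLaplacian.beta (X := PhiLaplacian.PerPair N T)
        (fun u => μ * PhiLaplacian.funI ρ Φ u + PhiLaplacian.funPsi F u)
        (PhiLaplacian.funPhi G) r →
    ∃ R : ℝ, 0 < R ∧
      ∀ lam ∈ Set.Icc a b, ∃ δ : ℝ, 0 < δ ∧
        ∀ ν ∈ Set.Icc 0 δ, ∃ u : Fin 3 → PhiLaplacian.PerPair N T,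
          Function.Injective u ∧ ∀ k,
            PhiLaplacian.IsSolution ρ φ (PhiLaplacian.potW F G H lam ν) μ (u k) ∧
            PhiLaplacian.normPair θ (u k) < R := by
  intro r _ μ hμ a b hab ha hb
  have hT0 : 0 < T := by omega
  rw [max_lt_iff] at hμ
  have hμ0 : 0 < μ := EReal.coe_pos.1 hμ.1
  have hΦ0 : ∀ i x, 0 ≤ Φ i x := fun i => (hA1 i).2.2.2.2.1
  have hΦc : ∀ i, ContDiff ℝ 1 (Φ i) := fun i => (hA1 i).2.2.2.1
  have hΦg : ∀ i x, HasGradientAt (Φ i) (φ i x) x := fun i => (hA1 i).2.2.1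
  have hI0 : ∀ u : PerPair N T, 0 ≤ funI ρ Φ u := funI_nonneg hρ hΦ0
  obtain ⟨C₁, hC₁⟩ := exists_le_funPsi_add_funPhi hA5 one_pos
  obtain ⟨v₀, L₀, hv₀, hL₀, hL₀r⟩ := exists_lt_level_of_muStar_lt hI0
    ⟨C₁, by rintro _ ⟨u, rfl⟩; simpa using hC₁ u⟩ hμ0 hμ.2
  obtain ⟨v₁, hv₁, hL₁⟩ := exists_lt_sInf_of_lt_beta hb
  have hbdd : BddBelow ((fun u : PerPair N T => μ * funI ρ Φ u + funPsi F u) ''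
      {x | funPhi G x ≤ r}) := by
    refine ⟨C₁ - r, ?_⟩
    rintro _ ⟨u, hu, rfl⟩
    have hu' : funPhi G u ≤ r := hu
    have := mul_nonneg hμ0.le (hI0 u)
    simp only
    linarith [hC₁ u]
  have hL₁r : ∀ v : PerPair N T, funPhi G v = r →
      sInf ((fun u : PerPair N T => μ * funI ρ Φ u + funPsi F u) '' {x | funPhi G x ≤ r}) ≤
        μ * funI ρ Φ v + funPsi F v := fun v hv => csInf_le hbdd ⟨v, hv.le, rfl⟩
  generalize sInf ((fun u : PerPair N T => μ * funI ρ Φ u + funPsi F u) ''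
    {x | funPhi G x ≤ r}) = L₁ at hL₁ hL₁r
  have := finiteDimensional_perSeq (N := N) hT0
  -- Linear coordinates supply the inner product structure that the gradient step requires.
  let e : EuclideanSpace ℝ (Fin (Module.finrank ℝ (PerPair N T))) ≃ₗ[ℝ] PerPair N T :=
    LinearEquiv.ofFinrankEq _ _ (by simp)
  have hIe := contDiff_funI e.toLinearMap (ρ := ρ) hΦc
  have hFe := contDiff_funSum e.toLinearMap hF
  have hGe := contDiff_funSum e.toLinearMap hG
  have hHe := contDiff_funSum e.toLinearMap hH
  obtain ⟨R, hR, hmain⟩ := exists_three_critical_points_of_perturbation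
    (J := fun x => μ * funI ρ Φ (e x) + funPsi F (e x)) (P := fun x => funPhi G (e x))
    (Γ := fun x => -funSum H (e x)) (a := a) (b := b) (r := r) (u₀ := e.symm v₀) (u₁ := e.symm v₁)
    ((contDiff_const.mul hIe).add hFe.neg) hGe hHe.neg
    (fun lam hlam c => isCompact_sublevel e.injective hT0 hρ hΦ0 hΦc hA4.1 hF hG hA5
      (ha.trans_le hlam.1) hμ0 c)
    (by simpa using hv₀) (by simpa using hv₁)
    (fun lam hlam => by
      -- The height of the wall: `v₀` lies below it as `lam > 0` and `Φ(v₀) < r`, and `v₁` as `lam ≤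
      -- b` and `Φ(v₁) > r`.
      refine ⟨max L₀ L₁ + lam * r, fun x hx => ?_, ?_, ?_⟩
      · rw [hx]
        gcongr
        exact max_le (hL₀r _ hx) (hL₁r _ hx)
      · simp only [LinearEquiv.apply_symm_apply]
        have := mul_lt_mul_of_pos_left hv₀ (ha.trans_le hlam.1)
        linarith [le_max_left L₀ L₁]
      · simp only [LinearEquiv.apply_symm_apply]
        have := mul_le_mul_of_nonneg_right hlam.2 (sub_nonneg.2 hv₁.le)
        linarith [le_max_right L₀ L₁])
  have hθ : 0 < θ := by linarith [hA3.1]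
  -- Continuity of the norm of `E` on a compact coordinate ball converts the Euclidean bound into
  -- one for `normPair`.
  obtain ⟨B, hB⟩ := ((isCompact_closedBall (0 : EuclideanSpace ℝ _) R).image
    (continuous_normPair e.toLinearMap hθ)).bddAbove
  refine ⟨max B 0 + 1, by positivity, fun lam hlam => ?_⟩
  obtain ⟨δ, hδ, hδ'⟩ := hmain lam hlam
  refine ⟨δ, hδ, fun ν hν => ?_⟩
  obtain ⟨w, hw, hwk⟩ := hδ' ν hν
  refine ⟨fun k => e (w k), e.injective.comp hw, fun k => ⟨?_, ?_⟩⟩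
  · refine isSolution_of_hasDerivAt_zero hT0 (fun i => (hρ i).1) hΦg
      (condA2_potW hF hG hH lam ν) fun v => ?_
    have hdiff : ContDiff ℝ 1 fun x => μ * funI ρ Φ (e x) + funPsi F (e x) +
        lam * funPhi G (e x) + ν * -funSum H (e x) :=
      (((contDiff_const.mul hIe).add hFe.neg).add (contDiff_const.mul hGe)).add
        (contDiff_const.mul hHe.neg)
    have hcrit := (hdiff.differentiable one_ne_zero (w k)).hasFDerivAt
    rw [(hwk k).1] at hcrit
    have hline : HasDerivAt (fun s : ℝ => w k + s • e.symm v) (e.symm v) 0 := by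
      simpa using ((hasDerivAt_id (0 : ℝ)).smul_const (e.symm v)).const_add (w k)
    rw [show w k = w k + (0 : ℝ) • e.symm v by simp] at hcrit
    have hcomp := hcrit.comp_hasDerivAt (f := fun s : ℝ => w k + s • e.symm v) (0 : ℝ) hline
    refine hcomp.congr_of_eventuallyEq (Eventually.of_forall fun s => ?_)
    simp only [Function.comp_apply, map_add, map_smul, LinearEquiv.apply_symm_apply, funSum_potW,
      funPsi, funPhi]
    ring
  · have : normPair θ (e (w k)) ≤ B :=
      hB ⟨w k, mem_closedBall_zero_iff.2 (hwk k).2.le, rfl⟩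
    linarith [le_max_left B 0]
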